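/- Let $\Bbbk$ be a field. A preassociative algebra is a $\Bbbk$-space $C$ with bilinear operations $\succ,\prec$ such that $(x\succ y+x\prec y)\succ z=x\succ(y\succ z)$, $(x\succ y)\prec z=x\succ(y\prec z)$ and $x\prec(y\succ z+y\prec z)=(x\prec y)\prec z$. An (associative) RB-algebra of weight $0$ is an associative, not necessarily unital, $\Bbbk$-algebra $B$ with a linear operator $R$ such that $R(x)R(y)=R(R(x)y+xR(y))$; with $x\succ y=R(x)y$, $x\prec y=xR(y)$ the space $B$ is a preassociative algebra. Let $U(C)$ denote the universal enveloping RB-algebra of $C$, i.e. the value at $C$ of the left adjoint of this functor from RB-algebras of weight $0$ to preassociative algebras. Fix an integer $w\ge 0$ and filter $U(C)$ by letting $F_n$ be the span of all monomials of degree at most $n$ in elements of (the image of) $C$, where every factor from $C$ has degree $1$ and every application of $R$ has degree $w$ (the usual filtration, by the number of factors from $C$, is $w=0$). Let $\mathrm{gr}\,U(C)=\bigoplus_{n\ge 0}F_n/F_{n-1}$ (with $F_{-1}=0$) be the associated graded RB-algebra, and let $\mathrm{Ab}\,C$ be the space $C$ with both operations zero. The pair of varieties $(\mathrm{RB\,As},\mathrm{pre\,As})$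 is called a PBW-pair if $\mathrm{gr}\,U(C)\cong U(\mathrm{Ab}\,C)$ as RB-algebras for every preassociative algebra $C$. Corollary 1. For every field $\Bbbk$ and every $w\ge 0$, the pair of varieties $(\mathrm{RB\,As},\mathrm{pre\,As})$, with Rota–Baxter weight $0$, is not a PBW-pair: there is a preassociative algebra $C$ over $\Bbbk$ such that $\mathrm{gr}\,U(C)$ and $U(\mathrm{Ab}\,C)$ are not isomorphic as RB-algebras. -/

import Mathlib

universe u v v'

set_option linter.unusedSectionVars false

/-- A preassociative algebra (dendriform dialgebra) over `k`: a `k`-space with two bilinear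
operations `a ≻ b = succ a b` and `a ≺ b = prec a b` and the three defining identities. -/
class PreassociativeAlgebra (k : Type u) (C : Type v) [Field k] [AddCommGroup C]
    [Module k C] where
  succ (k) : C →ₗ[k] C →ₗ[k] C
  prec (k) : C →ₗ[k] C →ₗ[k] C
  succ_succ (x y z : C) : succ (succ x y + prec x y) z = succ x (succ y z)
  prec_succ (x y z : C) : prec (succ x y) z = succ x (prec y z)
  prec_prec (x y z : C) : prec x (succ y z + prec y z) = prec (prec x y) z

/-- An associative Rota-Baxter algebra of weight `0` over `k`: an associative `k`-algebra, not
assumed to have a unit, with a linear operator `R` such that `R x R y = R (R x y + x R y)`. -/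
class RotaBaxterAlgebra (k : Type u) (B : Type v) [Field k] [NonUnitalRing B] [Module k B]
    [IsScalarTower k B B] [SMulCommClass k B B] where
  R (k) : B →ₗ[k] B
  rota_baxter (x y : B) : R x * R y = R (R x * y + x * R y)

/-- An isomorphism of associative Rota-Baxter algebras. -/
structure RotaBaxterEquiv (k : Type u) (B : Type v) (B' : Type v') [Field k]
    [NonUnitalRing B] [Module k B] [IsScalarTower k B B] [SMulCommClass k B B]
    [RotaBaxterAlgebra k B]
    [NonUnitalRing B'] [Module k B'] [IsScalarTower k B' B'] [SMulCommClass k B' B']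
    [RotaBaxterAlgebra k B'] extends B ≃ₗ[k] B' where
  map_mul (x y : B) : toFun (x * y) = toFun x * toFun y
  map_R (x : B) : toFun (RotaBaxterAlgebra.R k x) = RotaBaxterAlgebra.R k (toFun x)

/-- The functor from Rota-Baxter algebras to preassociative algebras: the same vector space with
`x ≻ y = R x y` and `x ≺ y = x R y`. -/
@[reducible] def RotaBaxterAlgebra.toPreassociative (k : Type u) (B : Type v) [Field k]
    [NonUnitalRing B] [Module k B] [IsScalarTower k B B] [SMulCommClass k B B]
    [RotaBaxterAlgebra k B] : PreassociativeAlgebra k B where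
  succ := (LinearMap.mul k B).comp (R k)
  prec := ((LinearMap.mul k B).flip.comp (R k)).flip
  succ_succ x y z := by
    simp [← rota_baxter, mul_assoc]
  prec_succ x y z := by
    simp [mul_assoc]
  prec_prec x y z := by
    simp [← rota_baxter, mul_assoc]

/-- `PreAb C` is the vector space `C` with both operations zero. -/
def PreAb (C : Type v) : Type v := C

instance (C : Type v) [AddCommGroup C] : AddCommGroup (PreAb C) := inferInstanceAs (AddCommGroup C)

instance (k : Type u) (C : Type v) [Field k] [AddCommGroup C] [Module k C] :
    Module k (PreAb C) := inferInstanceAs (Module k C)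

instance (k : Type u) (C : Type v) [Field k] [AddCommGroup C] [Module k C] :
    PreassociativeAlgebra k (PreAb C) where
  succ := 0
  prec := 0
  succ_succ _ _ _ := by simp
  prec_succ _ _ _ := by simp
  prec_prec _ _ _ := by simp

/-! ### The universal enveloping Rota-Baxter algebra -/

section Enveloping

variable (k : Type u) (C : Type v)

/-- Formal expressions in elements of `C`. -/
inductive EnvTerm : Type (max u v)
  | of : C → EnvTerm
  | zero : EnvTerm
  | add : EnvTerm → EnvTerm → EnvTerm
  | smul : k → EnvTerm → EnvTerm
  | mul : EnvTerm → EnvTerm → EnvTerm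
  | op : EnvTerm → EnvTerm

variable [Field k] [AddCommGroup C] [Module k C] [PreassociativeAlgebra k C]

open PreassociativeAlgebra in
/-- The least congruence on expressions that makes the quotient an associative Rota-Baxter algebra
of weight `0` and the map from `C` a homomorphism of preassociative algebras. -/
inductive EnvRel : EnvTerm k C → EnvTerm k C → Prop
  | refl (x) : EnvRel x x
  | symm {x y} : EnvRel x y → EnvRel y x
  | trans {x y z} : EnvRel x y → EnvRel y z → EnvRel x z
  | add_congr {x x' y y'} : EnvRel x x' → EnvRel y y' → EnvRel (.add x y) (.add x' y')
  | smul_congr (r) {x x'} : EnvRel x x' → EnvRel (.smul r x) (.smul r x')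
  | mul_congr {x x' y y'} : EnvRel x x' → EnvRel y y' → EnvRel (.mul x y) (.mul x' y')
  | op_congr {x x'} : EnvRel x x' → EnvRel (.op x) (.op x')
  | add_assoc (x y z) : EnvRel (.add (.add x y) z) (.add x (.add y z))
  | add_comm (x y) : EnvRel (.add x y) (.add y x)
  | zero_add (x) : EnvRel (.add .zero x) x
  | zero_smul (x) : EnvRel (.smul 0 x) .zero
  | one_smul (x) : EnvRel (.smul 1 x) x
  | mul_smul (r s x) : EnvRel (.smul (r * s) x) (.smul r (.smul s x))
  | add_smul (r s x) : EnvRel (.smul (r + s) x) (.add (.smul r x) (.smul s x))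
  | smul_add (r x y) : EnvRel (.smul r (.add x y)) (.add (.smul r x) (.smul r y))
  | mul_assoc (x y z) : EnvRel (.mul (.mul x y) z) (.mul x (.mul y z))
  | add_mul (x y z) : EnvRel (.mul (.add x y) z) (.add (.mul x z) (.mul y z))
  | mul_add (x y z) : EnvRel (.mul x (.add y z)) (.add (.mul x y) (.mul x z))
  | smul_mul (r x y) : EnvRel (.mul (.smul r x) y) (.smul r (.mul x y))
  | mul_smul_comm (r x y) : EnvRel (.mul x (.smul r y)) (.smul r (.mul x y))
  | op_add (x y) : EnvRel (.op (.add x y)) (.add (.op x) (.op y))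
  | op_smul (r x) : EnvRel (.op (.smul r x)) (.smul r (.op x))
  | rota_baxter (x y) : EnvRel (.mul (.op x) (.op y))
      (.op (.add (.mul (.op x) y) (.mul x (.op y))))
  | of_add (a b) : EnvRel (.of (a + b)) (.add (.of a) (.of b))
  | of_smul (r a) : EnvRel (.of (r • a)) (.smul r (.of a))
  | of_succ (a b) : EnvRel (.of (succ k a b)) (.mul (.op (.of a)) (.of b))
  | of_prec (a b) : EnvRel (.of (prec k a b)) (.mul (.of a) (.op (.of b)))

/-- Congruence of expressions, as a setoid. -/
def envSetoid : Setoid (EnvTerm k C) where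
  r := EnvRel k C
  iseqv := ⟨EnvRel.refl, EnvRel.symm, EnvRel.trans⟩

/-- The universal enveloping associative Rota-Baxter algebra (of weight `0`) of the preassociative
algebra `C`. -/
def Enveloping : Type (max u v) := Quotient (envSetoid k C)

namespace Enveloping

instance : Zero (Enveloping k C) := ⟨Quotient.mk (envSetoid k C) .zero⟩

instance : Add (Enveloping k C) :=
  ⟨Quotient.map₂ .add fun _ _ h _ _ h' => EnvRel.add_congr h h'⟩

instance : Mul (Enveloping k C) :=
  ⟨Quotient.map₂ .mul fun _ _ h _ _ h' => EnvRel.mul_congr h h'⟩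

instance : SMul k (Enveloping k C) :=
  ⟨fun r => Quotient.map (.smul r) fun _ _ h => EnvRel.smul_congr r h⟩

theorem zero_add_aux (x : Enveloping k C) : 0 + x = x := by
  induction x using Quotient.inductionOn
  exact Quotient.sound (EnvRel.zero_add _)

theorem add_comm_aux (x y : Enveloping k C) : x + y = y + x := by
  induction x, y using Quotient.inductionOn₂
  exact Quotient.sound (EnvRel.add_comm _ _)

theorem zero_smul_aux (x : Enveloping k C) : (0 : k) • x = 0 := by
  induction x using Quotient.inductionOn
  exact Quotient.sound (EnvRel.zero_smul _)

theorem one_smul_aux (x : Enveloping k C) : (1 : k) • x = x := by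
  induction x using Quotient.inductionOn
  exact Quotient.sound (EnvRel.one_smul _)

theorem add_smul_aux (r s : k) (x : Enveloping k C) : (r + s) • x = r • x + s • x := by
  induction x using Quotient.inductionOn
  exact Quotient.sound (EnvRel.add_smul _ _ _)

theorem mul_smul_aux (r s : k) (x : Enveloping k C) : (r * s) • x = r • s • x := by
  induction x using Quotient.inductionOn
  exact Quotient.sound (EnvRel.mul_smul _ _ _)

theorem smul_mul_aux (r : k) (x y : Enveloping k C) : (r • x) * y = r • (x * y) := by
  induction x, y using Quotient.inductionOn₂
  exact Quotient.sound (EnvRel.smul_mul _ _ _)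

theorem mul_smul_comm_aux (r : k) (x y : Enveloping k C) : x * (r • y) = r • (x * y) := by
  induction x, y using Quotient.inductionOn₂
  exact Quotient.sound (EnvRel.mul_smul_comm _ _ _)

instance : Neg (Enveloping k C) := ⟨fun x => (-1 : k) • x⟩

instance : NonUnitalRing (Enveloping k C) where
  add_assoc x y z := by
    induction x, y, z using Quotient.inductionOn₃
    exact Quotient.sound (EnvRel.add_assoc _ _ _)
  zero_add := zero_add_aux k C
  add_zero x := by rw [add_comm_aux, zero_add_aux]
  add_comm := add_comm_aux k C
  nsmul := nsmulRec
  zsmul := zsmulRec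
  neg_add_cancel x := by
    change (-1 : k) • x + x = 0
    conv_lhs => rw [← one_smul_aux k C x, ← mul_smul_aux, ← add_smul_aux]
    rw [mul_one, neg_add_cancel, zero_smul_aux]
  mul_assoc x y z := by
    induction x, y, z using Quotient.inductionOn₃
    exact Quotient.sound (EnvRel.mul_assoc _ _ _)
  left_distrib x y z := by
    induction x, y, z using Quotient.inductionOn₃
    exact Quotient.sound (EnvRel.mul_add _ _ _)
  right_distrib x y z := by
    induction x, y, z using Quotient.inductionOn₃
    exact Quotient.sound (EnvRel.add_mul _ _ _)
  zero_mul x := by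
    conv_lhs => rw [← zero_smul_aux k C 0, smul_mul_aux, zero_smul_aux]
  mul_zero x := by
    conv_lhs => rw [← zero_smul_aux k C 0, mul_smul_comm_aux, zero_smul_aux]

instance : Module k (Enveloping k C) where
  one_smul := one_smul_aux k C
  mul_smul := mul_smul_aux k C
  zero_smul := zero_smul_aux k C
  add_smul := add_smul_aux k C
  smul_zero r := by
    conv_lhs => rw [← zero_smul_aux k C 0, ← mul_smul_aux, mul_zero, zero_smul_aux]
  smul_add r x y := by
    induction x, y using Quotient.inductionOn₂
    exact Quotient.sound (EnvRel.smul_add _ _ _)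

instance : IsScalarTower k (Enveloping k C) (Enveloping k C) := ⟨smul_mul_aux k C⟩

instance : SMulCommClass k (Enveloping k C) (Enveloping k C) :=
  ⟨fun r x y => (mul_smul_comm_aux k C r x y).symm⟩

instance : RotaBaxterAlgebra k (Enveloping k C) where
  R :=
    { toFun := Quotient.map .op fun _ _ h => EnvRel.op_congr h
      map_add' := fun x y => by
        induction x, y using Quotient.inductionOn₂
        exact Quotient.sound (EnvRel.op_add _ _)
      map_smul' := fun r x => by
        induction x using Quotient.inductionOn
        exact Quotient.sound (EnvRel.op_smul _ _) }
  rota_baxter x y := by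
    induction x, y using Quotient.inductionOn₂
    exact Quotient.sound (EnvRel.rota_baxter _ _)

/-- The canonical linear map from `C` to its universal enveloping algebra. -/
def ι : C →ₗ[k] Enveloping k C where
  toFun a := Quotient.mk (envSetoid k C) (.of a)
  map_add' a b := Quotient.sound (EnvRel.of_add a b)
  map_smul' r a := Quotient.sound (EnvRel.of_smul r a)

theorem ι_succ (a b : C) :
    ι k C (PreassociativeAlgebra.succ k a b) = RotaBaxterAlgebra.R k (ι k C a) * ι k C b :=
  Quotient.sound (EnvRel.of_succ a b)

theorem ι_prec (a b : C) :
    ι k C (PreassociativeAlgebra.prec k a b) = ι k C a * RotaBaxterAlgebra.R k (ι k C b) :=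
  Quotient.sound (EnvRel.of_prec a b)

/-- Universal property: `Enveloping` is left adjoint to the functor `toPreassociative`, that is,
every homomorphism of preassociative algebras from `C` to a Rota-Baxter algebra `B` with the
operations of `toPreassociative` extends uniquely along `ι` to a homomorphism of Rota-Baxter
algebras. -/
theorem existsUnique_lift (B : Type v') [NonUnitalRing B] [Module k B] [IsScalarTower k B B]
    [SMulCommClass k B B] [RotaBaxterAlgebra k B] (f : C →ₗ[k] B)
    (hs : ∀ a b, f (PreassociativeAlgebra.succ k a b) =
      (RotaBaxterAlgebra.toPreassociative k B).succ (f a) (f b))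
    (hp : ∀ a b, f (PreassociativeAlgebra.prec k a b) =
      (RotaBaxterAlgebra.toPreassociative k B).prec (f a) (f b)) :
    ∃! g : Enveloping k C →ₗ[k] B, (∀ x y, g (x * y) = g x * g y) ∧
      (∀ x, g (RotaBaxterAlgebra.R k x) = RotaBaxterAlgebra.R k (g x)) ∧
      ∀ a, g (ι k C a) = f a := by
  replace hs : ∀ a b, f (PreassociativeAlgebra.succ k a b) =
    RotaBaxterAlgebra.R k (f a) * f b := hs
  replace hp : ∀ a b, f (PreassociativeAlgebra.prec k a b) =
    f a * RotaBaxterAlgebra.R k (f b) := hp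
  let ev : EnvTerm k C → B := fun t => EnvTerm.rec (motive := fun _ => B)
    (fun a => f a) 0 (fun _ _ x y => x + y) (fun r _ x => r • x) (fun _ _ x y => x * y)
    (fun _ x => RotaBaxterAlgebra.R k x) t
  have hev : ∀ s t, EnvRel k C s t → ev s = ev t := by
    intro s t h
    induction h with
    | refl => rfl
    | symm _ ih => exact ih.symm
    | trans _ _ ih ih' => exact ih.trans ih'
    | add_congr _ _ ih ih' => exact congrArg₂ (· + ·) ih ih'
    | smul_congr r _ ih => exact congrArg (r • ·) ih
    | mul_congr _ _ ih ih' => exact congrArg₂ (· * ·) ih ih'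
    | op_congr _ ih => exact congrArg (RotaBaxterAlgebra.R k) ih
    | add_assoc => exact add_assoc _ _ _
    | add_comm => exact add_comm _ _
    | zero_add => exact zero_add _
    | zero_smul => exact zero_smul _ _
    | one_smul => exact one_smul _ _
    | mul_smul => exact mul_smul _ _ _
    | add_smul => exact add_smul _ _ _
    | smul_add => exact smul_add _ _ _
    | mul_assoc => exact mul_assoc _ _ _
    | add_mul => exact add_mul _ _ _
    | mul_add => exact mul_add _ _ _
    | smul_mul => exact smul_mul_assoc _ _ _
    | mul_smul_comm => exact mul_smul_comm _ _ _
    | op_add => exact map_add _ _ _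
    | op_smul => exact map_smul _ _ _
    | rota_baxter => exact RotaBaxterAlgebra.rota_baxter _ _
    | of_add => exact map_add _ _ _
    | of_smul => exact map_smul _ _ _
    | of_succ => exact hs _ _
    | of_prec => exact hp _ _
  refine ⟨{ toFun := Quotient.lift ev hev, map_add' := ?_, map_smul' := ?_ },
    ⟨?_, ?_, ?_⟩, ?_⟩
  · intro x y
    induction x, y using Quotient.inductionOn₂
    rfl
  · intro r x
    induction x using Quotient.inductionOn
    rfl
  · intro x y
    induction x, y using Quotient.inductionOn₂
    rfl
  · intro x
    induction x using Quotient.inductionOn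
    rfl
  · intro a
    rfl
  · rintro g ⟨hm, hR, ho⟩
    ext x
    induction x using Quotient.inductionOn with | _ t
    induction t with
    | of a => exact ho a
    | zero => exact map_zero g
    | add s t ihs iht => exact (map_add g _ _).trans (congrArg₂ (· + ·) ihs iht)
    | smul r t iht => exact (map_smul g r _).trans (congrArg (r • ·) iht)
    | mul s t ihs iht => exact (hm _ _).trans (congrArg₂ (· * ·) ihs iht)
    | op t iht => exact (hR _).trans (congrArg (RotaBaxterAlgebra.R k) iht)

end Enveloping

end Enveloping

/-! ### Filtrations and associated graded algebras -/

/-- An ascending filtration of a Rota-Baxter algebra by subspaces, indexed by `ℕ`, such that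
`F i * F j ⊆ F (i + j)` and `R (F i) ⊆ F (i + w)`. -/
structure RBFiltration (k : Type u) (w : ℕ) (B : Type v) [Field k] [NonUnitalRing B]
    [Module k B] [IsScalarTower k B B] [SMulCommClass k B B] [RotaBaxterAlgebra k B] where
  F : ℕ → Submodule k B
  mono : Monotone F
  mul_mem {i j : ℕ} {x y : B} : x ∈ F i → y ∈ F j → x * y ∈ F (i + j)
  R_mem {i : ℕ} {x : B} : x ∈ F i → RotaBaxterAlgebra.R k x ∈ F (i + w)

namespace RBFiltration

section Graded

variable {k : Type u} {w : ℕ} {B : Type v} [Field k] [NonUnitalRing B] [Module k B]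
  [IsScalarTower k B B] [SMulCommClass k B B] [RotaBaxterAlgebra k B]
  (𝓕 : RBFiltration k w B)

/-- `lower n` is `F (n - 1)`, where `F (-1) = 0`. -/
def lower : ℕ → Submodule k B
  | 0 => ⊥
  | n + 1 => 𝓕.F n

theorem lower_mul {i j : ℕ} {x y : B} (hx : x ∈ 𝓕.lower i) (hy : y ∈ 𝓕.F j) :
    x * y ∈ 𝓕.lower (i + j) := by
  cases i with
  | zero =>
    have : x = 0 := hx
    rw [this, zero_mul]
    exact zero_mem _
  | succ i =>
    rw [Nat.succ_add_eq_add_succ]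
    exact 𝓕.mul_mem hx hy

theorem mul_lower {i j : ℕ} {x y : B} (hx : x ∈ 𝓕.F i) (hy : y ∈ 𝓕.lower j) :
    x * y ∈ 𝓕.lower (i + j) := by
  cases j with
  | zero =>
    have : y = 0 := hy
    rw [this, mul_zero]
    exact zero_mem _
  | succ j => exact 𝓕.mul_mem hx hy

theorem R_lower {i : ℕ} {x : B} (hx : x ∈ 𝓕.lower i) :
    RotaBaxterAlgebra.R k x ∈ 𝓕.lower (i + w) := by
  cases i with
  | zero =>
    have : x = 0 := hx
    rw [this, map_zero]
    exact zero_mem _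
  | succ i =>
    rw [Nat.succ_add_eq_add_succ]
    exact 𝓕.R_mem hx

/-- The homogeneous component `F n / F (n - 1)`. -/
abbrev Piece (n : ℕ) : Type v := 𝓕.F n ⧸ (𝓕.lower n).submoduleOf (𝓕.F n)

/-- The product `F i / F (i - 1) × F j / F (j - 1) → F (i + j) / F (i + j - 1)`. -/
def pieceMul (i j : ℕ) : 𝓕.Piece i →ₗ[k] 𝓕.Piece j →ₗ[k] 𝓕.Piece (i + j) :=
  Submodule.liftQ _
    (LinearMap.mk₂ k
      (fun (x : 𝓕.F i) (y : 𝓕.F j) =>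
        (Submodule.Quotient.mk ⟨(x : B) * y, 𝓕.mul_mem x.2 y.2⟩ : 𝓕.Piece (i + j)))
      (fun _ _ _ => congrArg Submodule.Quotient.mk (Subtype.ext (add_mul _ _ _)))
      (fun _ _ _ => congrArg Submodule.Quotient.mk (Subtype.ext (smul_mul_assoc _ _ _)))
      (fun _ _ _ => congrArg Submodule.Quotient.mk (Subtype.ext (mul_add _ _ _)))
      (fun _ _ _ => congrArg Submodule.Quotient.mk (Subtype.ext (mul_smul_comm _ _ _)))
      |>.flip |> Submodule.liftQ _ (h := fun y hy => by
        ext x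
        exact (Submodule.Quotient.mk_eq_zero _).2 (𝓕.mul_lower x.2 hy)) |>.flip)
    fun x hx => by
      ext y
      exact (Submodule.Quotient.mk_eq_zero _).2 (𝓕.lower_mul hx y.2)

/-- The operator `F i / F (i - 1) → F (i + w) / F (i + w - 1)` induced by `R`. -/
def pieceR (i : ℕ) : 𝓕.Piece i →ₗ[k] 𝓕.Piece (i + w) :=
  Submodule.mapQ _ _ ((RotaBaxterAlgebra.R k).restrict fun _ hx => 𝓕.R_mem hx)
    fun _ hx => 𝓕.R_lower hx

open scoped DirectSum in
/-- The associated graded algebra: the direct sum of all `F n / F (n - 1)`. -/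
abbrev Gr : Type v := ⨁ n, 𝓕.Piece n

namespace Gr

/-- The inclusion of the `n`-th homogeneous component. -/
def incl (n : ℕ) : 𝓕.Piece n →ₗ[k] 𝓕.Gr := DirectSum.lof k ℕ 𝓕.Piece n

/-- The product of the associated graded algebra. -/
def mulLin : 𝓕.Gr →ₗ[k] 𝓕.Gr →ₗ[k] 𝓕.Gr :=
  DirectSum.toModule k ℕ _ fun i =>
    (DirectSum.toModule k ℕ (𝓕.Piece i →ₗ[k] 𝓕.Gr) fun j =>
      ((𝓕.pieceMul i j).compr₂ (incl 𝓕 (i + j))).flip).flip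

/-- The operator of the associated graded algebra. -/
def RLin : 𝓕.Gr →ₗ[k] 𝓕.Gr :=
  DirectSum.toModule k ℕ _ fun i => (incl 𝓕 (i + w)).comp (𝓕.pieceR i)

/-- The class in `F n / F (n - 1)` of an element of `F n`. -/
def symb (n : ℕ) (x : B) (hx : x ∈ 𝓕.F n) : 𝓕.Gr := incl 𝓕 n (Submodule.Quotient.mk ⟨x, hx⟩)

theorem symb_congr {m n : ℕ} {x y : B} (h : m = n) (hxy : x = y) (hx : x ∈ 𝓕.F m)
    (hy : y ∈ 𝓕.F n) : symb 𝓕 m x hx = symb 𝓕 n y hy := by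
  subst h hxy
  rfl

theorem symb_add {n : ℕ} {x y : B} (hx : x ∈ 𝓕.F n) (hy : y ∈ 𝓕.F n) :
    symb 𝓕 n (x + y) (add_mem hx hy) = symb 𝓕 n x hx + symb 𝓕 n y hy :=
  map_add (incl 𝓕 n) (Submodule.Quotient.mk ⟨x, hx⟩ : 𝓕.Piece n)
    (Submodule.Quotient.mk ⟨y, hy⟩ : 𝓕.Piece n)

theorem mulLin_symb {i j : ℕ} {x y : B} (hx : x ∈ 𝓕.F i) (hy : y ∈ 𝓕.F j) :
    mulLin 𝓕 (symb 𝓕 i x hx) (symb 𝓕 j y hy) = symb 𝓕 (i + j) (x * y) (𝓕.mul_mem hx hy) := by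
  unfold mulLin symb incl
  rw [DirectSum.toModule_lof, LinearMap.flip_apply, DirectSum.toModule_lof]
  rfl

theorem RLin_symb {i : ℕ} {x : B} (hx : x ∈ 𝓕.F i) :
    RLin 𝓕 (symb 𝓕 i x hx) = symb 𝓕 (i + w) (RotaBaxterAlgebra.R k x) (𝓕.R_mem hx) := by
  unfold RLin symb incl
  rw [DirectSum.toModule_lof]
  rfl

theorem induction_symb {p : 𝓕.Gr → Prop} (h0 : p 0) (hs : ∀ n x hx, p (symb 𝓕 n x hx))
    (ha : ∀ x y, p x → p y → p (x + y)) (x : 𝓕.Gr) : p x := by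
  refine DirectSum.induction_on (motive := p) x h0 (fun n y => ?_) ha
  obtain ⟨y, rfl⟩ := Submodule.Quotient.mk_surjective _ y
  exact hs n y y.2

instance : Mul 𝓕.Gr := ⟨fun x y => mulLin 𝓕 x y⟩

theorem symb_mul {i j : ℕ} {x y : B} (hx : x ∈ 𝓕.F i) (hy : y ∈ 𝓕.F j) :
    symb 𝓕 i x hx * symb 𝓕 j y hy = symb 𝓕 (i + j) (x * y) (𝓕.mul_mem hx hy) :=
  mulLin_symb 𝓕 hx hy

instance : NonUnitalNonAssocRing 𝓕.Gr where
  left_distrib x y z := map_add (mulLin 𝓕 x) y z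
  right_distrib x y z := LinearMap.map_add₂ (mulLin 𝓕) x y z
  zero_mul x := LinearMap.map_zero₂ (mulLin 𝓕) x
  mul_zero x := map_zero (mulLin 𝓕 x)

instance : NonUnitalRing 𝓕.Gr where
  mul_assoc x y z := by
    induction x using induction_symb with
    | h0 => simp only [zero_mul]
    | ha x x' hx hx' => simp only [add_mul, hx, hx']
    | hs i x hx =>
      induction y using induction_symb with
      | h0 => simp only [zero_mul, mul_zero]
      | ha y y' hy hy' => simp only [add_mul, mul_add, hy, hy']
      | hs j y hy =>
        induction z using induction_symb with
        | h0 => simp only [mul_zero]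
        | ha z z' hz hz' => simp only [mul_add, hz, hz']
        | hs l z hz =>
          simp only [symb_mul]
          exact symb_congr 𝓕 (add_assoc _ _ _) (mul_assoc _ _ _) _ _

instance : IsScalarTower k 𝓕.Gr 𝓕.Gr := ⟨fun r x y => LinearMap.map_smul₂ (mulLin 𝓕) r x y⟩

instance : SMulCommClass k 𝓕.Gr 𝓕.Gr := ⟨fun r x y => (map_smul (mulLin 𝓕 x) r y).symm⟩

instance : RotaBaxterAlgebra k 𝓕.Gr where
  R := RLin 𝓕
  rota_baxter x y := by
    induction x using induction_symb with
    | h0 => simp only [map_zero, zero_mul, add_zero]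
    | ha x x' hx hx' =>
      simp only [map_add, add_mul, hx, hx']
      abel
    | hs i x hx =>
      induction y using induction_symb with
      | h0 => simp only [map_zero, mul_zero, add_zero]
      | ha y y' hy hy' =>
        simp only [map_add, mul_add, hy, hy']
        abel
      | hs j y hy =>
        simp only [RLin_symb, symb_mul, map_add]
        rw [symb_congr 𝓕 (show i + (j + w) + w = i + w + j + w by omega) rfl _
          (𝓕.R_mem (show x * RotaBaxterAlgebra.R k y ∈ 𝓕.F (i + w + j) from
            (show i + (j + w) = i + w + j by omega) ▸ 𝓕.mul_mem hx (𝓕.R_mem hy))), ← symb_add]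
        exact symb_congr 𝓕 (by omega) (by rw [RotaBaxterAlgebra.rota_baxter, map_add]) _ _

end Gr

end Graded

end RBFiltration

/-! ### The natural filtration of the enveloping algebra and the PBW property -/

namespace Enveloping

variable (k : Type u) (C : Type v) [Field k] [AddCommGroup C] [Module k C]
  [PreassociativeAlgebra k C]

/-- `IsMonomial k C w n x`: the element `x` is the value of a monomial in elements of `C`
(built from them by the product and `R`) of degree `n`, where each occurrence of an element of
`C` contributes `1` and each occurrence of `R` contributes `w`. -/
inductive IsMonomial (w : ℕ) : ℕ → Enveloping k C → Prop
  | of (a : C) : IsMonomial w 1 (ι k C a)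
  | mul {m n : ℕ} {x y : Enveloping k C} :
      IsMonomial w m x → IsMonomial w n y → IsMonomial w (m + n) (x * y)
  | op {n : ℕ} {x : Enveloping k C} :
      IsMonomial w n x → IsMonomial w (n + w) (RotaBaxterAlgebra.R k x)

/-- The natural ascending filtration: `F n` is spanned by the monomials of degree at most `n`. -/
def filtration (w : ℕ) : RBFiltration k w (Enveloping k C) where
  F n := Submodule.span k {x | ∃ m ≤ n, IsMonomial k C w m x}
  mono i j h := Submodule.span_mono fun _ ⟨m, hm, hx⟩ => ⟨m, hm.trans h, hx⟩
  mul_mem {i j x y} hx hy := by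
    induction hx using Submodule.span_induction with
    | zero => rw [zero_mul]; exact zero_mem _
    | add x x' _ _ h h' => rw [add_mul]; exact add_mem h h'
    | smul r x _ h => rw [smul_mul_assoc]; exact Submodule.smul_mem _ _ h
    | mem x hx =>
      obtain ⟨m, hm, hx⟩ := hx
      induction hy using Submodule.span_induction with
      | zero => rw [mul_zero]; exact zero_mem _
      | add y y' _ _ h h' => rw [mul_add]; exact add_mem h h'
      | smul r y _ h => rw [mul_smul_comm]; exact Submodule.smul_mem _ _ h
      | mem y hy =>
        obtain ⟨n, hn, hy⟩ := hy
        exact Submodule.subset_span ⟨m + n, add_le_add hm hn, hx.mul hy⟩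
  R_mem {i x} hx := by
    induction hx using Submodule.span_induction with
    | zero => rw [map_zero]; exact zero_mem _
    | add x x' _ _ h h' => rw [map_add]; exact add_mem h h'
    | smul r x _ h => rw [map_smul]; exact Submodule.smul_mem _ _ h
    | mem x hx =>
      obtain ⟨m, hm, hx⟩ := hx
      exact Submodule.subset_span ⟨m + w, by omega, hx.op⟩

end Enveloping

/-- The pair (associative Rota-Baxter algebras of weight `0`, preassociative algebras) over `k` is
a PBW-pair: for every preassociative algebra `C`, the associated graded algebra of the universal
enveloping algebra of `C`, with respect to the natural filtration in which `R` has degree `w`,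
is isomorphic to the universal enveloping algebra of `PreAb C`. The usual filtration, by the number
of factors from `C`, is the case `w = 0`. -/
def IsPBWPairRBAsPreAs (k : Type u) [Field k] (w : ℕ) : Prop :=
  ∀ (C : Type u) [AddCommGroup C] [Module k C] [PreassociativeAlgebra k C],
    Nonempty (RotaBaxterEquiv k (Enveloping.filtration k C w).Gr (Enveloping k (PreAb C)))

/-!
For elements `x, y, z` of a preassociative algebra `C`, evaluating `x R(y) z` in the enveloping
algebra in two ways gives `(x ≺ y) z = x (y ≻ z)`. On the line `C = k` with `x ≻ y = x y` and
`x ≺ y = 0` this forces every product of two elements of `C` to vanish in `U(C)`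
(`ι_mul_ι_of_leftRegular`), hence also in `gr U(C)`, which is generated by `C`. A multiplicative
functional `gr U(C) → k` that kills the image of `R` then vanishes on `C`, since its values there
square to zero, and so vanishes identically (`gr_functional_eq_zero`). On the other hand
`U(Ab C)` has a nonzero functional of this kind: `k` with the zero operator is a Rota-Baxter algebra,
and the identity map `C → k` extends to `U(Ab C)`. So the two algebras are not isomorphic, whatever
the degree `w` of `R`.
-/

/-- The preassociative structure on the line `k` with `x ≻ y = x y` and `x ≺ y = 0`. -/
@[reducible] def leftRegularPreassociative (k : Type u) [Field k] : PreassociativeAlgebra k k where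
  succ := LinearMap.mul k k
  prec := 0
  succ_succ x y z := by simp [mul_assoc]
  prec_succ x y z := by simp
  prec_prec x y z := by simp

/-- The field `k` as a Rota-Baxter algebra with zero operator. -/
@[reducible] def zeroRotaBaxter (k : Type u) [Field k] : RotaBaxterAlgebra k k where
  R := 0
  rota_baxter x y := by simp

namespace Enveloping

theorem ι_mul_ι_of_leftRegular (k : Type u) [Field k] (a b : k) :
    letI := leftRegularPreassociative k
    ι k k a * ι k k b = 0 := by
  let := leftRegularPreassociative k
  have hs : RotaBaxterAlgebra.R k (ι k k 1) * ι k k b = ι k k b := by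
    rw [← ι_succ]
    exact congrArg (ι k k) (one_mul b)
  have hp : ι k k a * RotaBaxterAlgebra.R k (ι k k 1) = 0 := by
    rw [← ι_prec]
    exact map_zero (ι k k)
  change ι k k a * ι k k b = 0
  rw [← hs, ← mul_assoc, hp, zero_mul]

variable (k : Type u) (C : Type v) [Field k] [AddCommGroup C] [Module k C]
  [PreassociativeAlgebra k C]

theorem IsMonomial.mem_filtration {w n : ℕ} {x : Enveloping k C} (hx : IsMonomial k C w n x) :
    x ∈ (filtration k C w).F n :=
  Submodule.subset_span ⟨n, le_rfl, hx⟩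

open RBFiltration Gr

/-- The associated graded algebra is generated by the symbols of the elements of `C`, so a
functional compatible with the product that kills the operator is determined by its values on
these symbols. -/
theorem gr_functional_eq_zero {w : ℕ} (h : (filtration k C w).Gr →ₗ[k] k)
    (hmul : ∀ x y, h (x * y) = h x * h y) (hR : ∀ x, h (RotaBaxterAlgebra.R k x) = 0)
    (hι : ∀ a, h (symb (filtration k C w) 1 (ι k C a) (IsMonomial.of a).mem_filtration) = 0) :
    h = 0 := by
  have hmon : ∀ {n : ℕ} {x : Enveloping k C} (hx : IsMonomial k C w n x),
      h (symb (filtration k C w) n x hx.mem_filtration) = 0 := by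
    intro n x hx
    induction hx with
    | of a => exact hι a
    | mul hx hy ihx _ =>
      rw [← symb_mul _ hx.mem_filtration hy.mem_filtration, hmul, ihx, zero_mul]
    | op hx _ =>
      exact (congrArg h (RLin_symb _ hx.mem_filtration)).symm.trans (hR _)
  refine LinearMap.ext fun x => ?_
  induction x using induction_symb with
  | h0 => exact map_zero h
  | ha x y hx hy => rw [map_add, hx, hy]; simp
  | hs n x hx =>
    let σ : (filtration k C w).F n →ₗ[k] k :=
      h.comp ((incl (filtration k C w) n).comp (Submodule.mkQ _))
    change σ ⟨x, hx⟩ = 0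
    -- `σ` vanishes on the spanning monomials of `F n`; those of degree below `n` have symbol `0`.
    induction hx using Submodule.span_induction with
    | zero => exact map_zero σ
    | add x y hx hy h₁ h₂ =>
      exact (map_add σ ⟨x, hx⟩ ⟨y, hy⟩).trans (by rw [h₁, h₂, add_zero])
    | smul r x hx h₁ => exact (map_smul σ r ⟨x, hx⟩).trans (by rw [h₁, smul_zero])
    | mem x hx =>
      obtain ⟨m, hm, hx⟩ := hx
      obtain rfl | hlt := hm.eq_or_lt
      · exact hmon hx
      · have hlow : x ∈ (filtration k C w).lower n := by
          cases n with
          | zero => omega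
          | succ n => exact (filtration k C w).mono (Nat.le_of_lt_succ hlt) hx.mem_filtration
        have h0 : Submodule.mkQ (((filtration k C w).lower n).submoduleOf ((filtration k C w).F n))
            ⟨x, Submodule.subset_span ⟨m, hm, hx⟩⟩ = 0 :=
          (Submodule.Quotient.mk_eq_zero _).2 hlow
        change h (incl _ n (Submodule.mkQ _ _)) = 0
        rw [h0, map_zero, map_zero]

end Enveloping

open Enveloping RBFiltration Gr in
theorem corollary1 (k : Type u) [Field k] (w : ℕ) : ¬ IsPBWPairRBAsPreAs k w := by
  intro hPBW
  let := leftRegularPreassociative k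
  let := zeroRotaBaxter k
  obtain ⟨φ⟩ := hPBW k
  let f : PreAb k →ₗ[k] k := (LinearMap.id : k →ₗ[k] k)
  obtain ⟨g, ⟨gmul, gR, gι⟩, -⟩ := existsUnique_lift k (PreAb k) k f
    (fun a b => (zero_mul (f b)).symm) (fun a b => (mul_zero (f a)).symm)
  have hzero : g.comp φ.toLinearEquiv.toLinearMap = 0 := by
    refine gr_functional_eq_zero k k _ (fun x y => ?_) (fun x => ?_) (fun a => ?_)
    · exact (congrArg g (φ.map_mul x y)).trans (gmul _ _)
    · exact (congrArg g (φ.map_R x)).trans (gR _)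
    · refine mul_self_eq_zero.1 ((gmul _ _).symm.trans ?_)
      refine (congrArg g (φ.map_mul _ _).symm).trans ?_
      rw [symb_mul, symb_congr _ rfl (ι_mul_ι_of_leftRegular k a a) _ (zero_mem _)]
      change g (φ.toLinearEquiv (incl _ _ 0)) = 0
      rw [map_zero, map_zero, map_zero]
  have h1 := LinearMap.congr_fun hzero (φ.toLinearEquiv.symm (ι k (PreAb k) (1 : k)))
  change g (φ.toLinearEquiv (φ.toLinearEquiv.symm _)) = 0 at h1
  rw [LinearEquiv.apply_symm_apply] at h1
  exact one_ne_zero ((gι (1 : k)).symm.trans h1)
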